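/- Let $\Bbbk$ be a field of characteristic different from $2$. A composition is a finite (possibly empty) sequence $\alpha=(a_1,\dots,a_m)$ of positive integers; write $|\alpha|=a_1+\cdots+a_m$, and call $\alpha$ even if every $a_i$ is even (so the empty composition is even). Let $$M_\alpha=\sum_{i_1<i_2<\cdots<i_m}x_{i_1}^{a_1}\cdots x_{i_m}^{a_m}$$ be the monomial quasi-symmetric function of $\alpha$, a formal power series over $\Bbbk$ in the variables $x_1,x_2,\dots$ (with $M_{()}=1$). Let $\mathcal{Q}\mathit{Sym}$ be the $\Bbbk$-algebra of quasi-symmetric functions, that is, the linear span of all $M_\alpha$ in the algebra of formal power series, graded by letting the component of degree $n$ be the span of the $M_\alpha$ with $|\alpha|=n$, with comultiplication $\Delta(M_\alpha)=\sum_{\alpha=\beta\gamma}M_\beta\otimes M_\gamma$ (the sum over all ways of writing $\alpha$ as a concatenation $\beta\gamma$) and with counit the projection onto degree $0$. Let $\zeta_{\mathcal Q}:\mathcal{Q}\mathit{Sym}\to\Bbbk$ be the algebra morphism that sets $x_1=1$ and $x_i=0$ for $i\neq 1$, and let $\overline{\zeta}_{\mathcal Q}$ be the functional with $\overline{\zeta}_{\mathcal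 Q}(h)=(-1)^n\zeta_{\mathcal Q}(h)$ for $h$ homogeneous of degree $n$. The even subalgebra $\Pi_+$ of $(\mathcal{Q}\mathit{Sym},\zeta_{\mathcal Q})$ is the largest graded subcoalgebra of $\mathcal{Q}\mathit{Sym}$ on which $\overline{\zeta}_{\mathcal Q}$ and $\zeta_{\mathcal Q}$ agree. Then the elements $M_\alpha$, where $\alpha$ runs over all even compositions, form a linear basis of $\Pi_+$. -/

import Mathlib

open scoped TensorProduct

noncomputable section

/-! ## Graded coalgebras, characters, and the even subalgebra -/

namespace CombHopf

section Coalgebra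

variable {k H : Type*} [Field k] [AddCommGroup H] [Module k H]
variable (𝒜 : ℕ → Submodule k H) [DirectSum.Decomposition 𝒜]

/-- The canonical involution `h ↦ (-1) ^ n h` (for `h` homogeneous of degree `n`) of a graded
vector space. -/
def signInvolution : H →ₗ[k] H :=
  DirectSum.toModule k ℕ H (fun n => ((-1 : k) ^ n) • (𝒜 n).subtype) ∘ₗ
    (DirectSum.decomposeLinearEquiv 𝒜).toLinearMap

theorem signInvolution_of_mem {n : ℕ} {h : H} (hh : h ∈ 𝒜 n) :
    signInvolution 𝒜 h = (-1 : k) ^ n • h := by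
  simp only [signInvolution, LinearMap.comp_apply, LinearEquiv.coe_coe,
    DirectSum.decomposeLinearEquiv_apply]
  rw [DirectSum.decompose_of_mem 𝒜 hh]
  erw [DirectSum.toModule_lof]
  simp

/-- The functional `φ̄`, given by `φ̄ h = (-1) ^ n φ h` for `h` homogeneous of degree `n`. -/
def bar (φ : H →ₗ[k] k) : H →ₗ[k] k := φ ∘ₗ signInvolution 𝒜

variable [Coalgebra k H]

/-- A graded subcoalgebra of a graded coalgebra: a subspace `C` that contains the homogeneous
components of its elements and satisfies `Δ(C) ⊆ C ⊗ C` inside `H ⊗ H`. -/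
structure IsGradedSubcoalgebra (C : Submodule k H) : Prop where
  homogeneous : DirectSum.SetLike.IsHomogeneous 𝒜 C
  comul_mem : ∀ h ∈ C, (CoalgebraStruct.comul h : H ⊗[k] H) ∈
    LinearMap.range (TensorProduct.map C.subtype C.subtype)

/-- `S(φ, ψ)`: the largest graded subcoalgebra on which `φ` and `ψ` agree, constructed as the sum of
all such graded subcoalgebras. -/
def largestSubcoalgebra (φ ψ : H →ₗ[k] k) : Submodule k H :=
  sSup {C | IsGradedSubcoalgebra 𝒜 C ∧ ∀ h ∈ C, φ h = ψ h}

/-- `S(φ, ψ)` is itself a graded subcoalgebra on which `φ` and `ψ` agree, so it is the largest. -/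
theorem isGreatest_largestSubcoalgebra (φ ψ : H →ₗ[k] k) :
    IsGreatest {C | IsGradedSubcoalgebra 𝒜 C ∧ ∀ h ∈ C, φ h = ψ h}
      (largestSubcoalgebra 𝒜 φ ψ) := by
  refine ⟨⟨⟨?_, ?_⟩, ?_⟩, fun C hC => le_sSup hC⟩
  · intro i m hm
    have key : largestSubcoalgebra 𝒜 φ ψ ≤
        (largestSubcoalgebra 𝒜 φ ψ).comap ((𝒜 i).subtype ∘ₗ
          DirectSum.component k ℕ (fun n => 𝒜 n) i ∘ₗ
            (DirectSum.decomposeLinearEquiv 𝒜).toLinearMap) := by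
      refine sSup_le fun C hC x hx => ?_
      exact (le_sSup hC : C ≤ largestSubcoalgebra 𝒜 φ ψ) (hC.1.homogeneous i hx)
    exact key hm
  · have key : largestSubcoalgebra 𝒜 φ ψ ≤
        (LinearMap.range (TensorProduct.map (largestSubcoalgebra 𝒜 φ ψ).subtype
          (largestSubcoalgebra 𝒜 φ ψ).subtype)).comap
            (CoalgebraStruct.comul : H →ₗ[k] H ⊗[k] H) := by
      refine sSup_le fun C hC x hx => ?_
      have hle : C ≤ largestSubcoalgebra 𝒜 φ ψ := le_sSup hC
      obtain ⟨t, ht⟩ := hC.1.comul_mem x hx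
      refine ⟨TensorProduct.map (Submodule.inclusion hle) (Submodule.inclusion hle) t, ?_⟩
      rw [← ht, ← LinearMap.comp_apply, ← TensorProduct.map_comp]
      rfl
    exact fun h hh => key hh
  · have key : largestSubcoalgebra 𝒜 φ ψ ≤ LinearMap.eqLocus φ ψ :=
      sSup_le fun C hC x hx => hC.2 x hx
    exact fun h hh => key hh

end Coalgebra

/-- The even subalgebra `S₊(H, ζ) = S(ζ̄, ζ)` of a graded algebra and coalgebra `H` with a
character `ζ`. -/
def evenSubalgebra {k H : Type*} [Field k] [Ring H] [Algebra k H] [Coalgebra k H]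
    (𝒜 : ℕ → Submodule k H) [DirectSum.Decomposition 𝒜] (ζ : H →ₐ[k] k) : Submodule k H :=
  largestSubcoalgebra 𝒜 (bar 𝒜 ζ.toLinearMap) ζ.toLinearMap

end CombHopf

/-! ## Quasi-symmetric functions -/

/-- A composition: a finite ordered list of positive integers (possibly empty). -/
abbrev IntComp : Type := List ℕ+

namespace IntComp

/-- `|α|`, the sum of the parts of a composition. -/
def size (α : IntComp) : ℕ := (α.map (fun a : ℕ+ => (a : ℕ))).sum

/-- A composition is even if all its parts are even. -/
def IsEven (α : IntComp) : Prop := ∀ a ∈ α, Even (a : ℕ)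

theorem finite_size_le (n : ℕ) : {α : IntComp | size α ≤ n}.Finite := by
  induction n with
  | zero =>
    refine (Set.finite_singleton ([] : IntComp)).subset fun α hα => ?_
    cases α with
    | nil => rfl
    | cons a l =>
      have := a.pos
      simp [size] at hα
  | succ n ih =>
    have hf : {a : ℕ+ | (a : ℕ) ≤ n + 1}.Finite :=
      (Set.finite_Iic (n + 1)).preimage (PNat.coe_injective.injOn)
    refine ((Set.finite_singleton ([] : IntComp)).union
      (Set.Finite.image2 List.cons hf ih)).subset fun α hα => ?_
    cases α with
    | nil => exact Or.inl rfl
    | cons a l =>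
      right
      have := a.pos
      simp only [size, List.map_cons, List.sum_cons, Set.mem_ofPred_eq] at hα
      exact ⟨a, by simp only [Set.mem_ofPred_eq]; omega, l,
        by simp only [size, Set.mem_ofPred_eq]; omega, rfl⟩

end IntComp

namespace QuasiSym

/-- The exponent vector of the monomial `x_{i₁} ^ a₁ ⋯ x_{iₘ} ^ aₘ`, where `α = (a₁, …, aₘ)`. -/
def expo (α : IntComp) (i : Fin α.length ↪o ℕ) : ℕ →₀ ℕ :=
  ∑ j, Finsupp.single (i j) (α.get j : ℕ)

/-- The monomial quasi-symmetric function `M_α = ∑_{i₁ < ⋯ < iₘ} x_{i₁} ^ a₁ ⋯ x_{iₘ} ^ aₘ`, as a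
formal power series in the variables `x_0, x_1, x_2, …` (the variables are numbered from `0`): the
coefficient of a monomial is the number of index sequences `i₁ < ⋯ < iₘ` that produce it. -/
def monomialPS (k : Type*) [Field k] (α : IntComp) : MvPowerSeries ℕ k :=
  fun d => (({i : Fin α.length ↪o ℕ | expo α i = d}.ncard : ℕ) : k)

/-! ### Coefficients of the monomial quasi-symmetric functions -/

/-- The list of the nonzero exponents of a monomial. -/
def pack {σ : Type*} [LinearOrder σ] (d : σ →₀ ℕ) : List ℕ := d.support.sort.map d

theorem pack_embDomain {m : ℕ} (i : Fin m ↪o ℕ) (c : Fin m →₀ ℕ) :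
    pack (Finsupp.embDomain i.toEmbedding c) = pack c := by
  unfold pack
  rw [Finsupp.support_embDomain]
  have h := Finset.map_sort (s := c.support) (f := i.toEmbedding) (r := (· ≤ ·)) (r' := (· ≤ ·))
    (by intro a _ b _; simp)
  rw [← h, List.map_map]
  refine List.map_congr_left fun a _ => ?_
  simp only [Function.comp_apply]
  exact Finsupp.embDomain_apply_self i.toEmbedding c a

/-- The exponents of a composition, as a function on positions. -/
def parts (α : IntComp) : Fin α.length →₀ ℕ :=
  Finsupp.equivFunOnFinite.symm fun j => (α.get j : ℕ)

theorem expo_eq_embDomain (α : IntComp) (i : Fin α.length ↪o ℕ) :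
    expo α i = Finsupp.embDomain i.toEmbedding (parts α) := by
  have h : parts α = ∑ j, Finsupp.single j (α.get j : ℕ) := by
    ext j
    simp [parts, Finsupp.finsetSum_apply, Finsupp.single_apply]
  rw [h, expo, Finsupp.embDomain_eq_mapDomain, Finsupp.mapDomain_finsetSum]
  simp [Finsupp.mapDomain_single]

theorem support_parts (α : IntComp) : (parts α).support = Finset.univ := by
  ext j
  simp [parts]

theorem pack_expo (α : IntComp) (i : Fin α.length ↪o ℕ) :
    pack (expo α i) = α.map (fun a : ℕ+ => (a : ℕ)) := by
  rw [expo_eq_embDomain, pack_embDomain, pack, support_parts, Fin.sort_univ]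
  conv_rhs => rw [← List.map_get_finRange α]
  rw [List.map_map]
  rfl

theorem expo_injective (α : IntComp) : Function.Injective (expo α) := by
  intro i i' h
  have hs := congrArg Finsupp.support h
  rw [expo_eq_embDomain, expo_eq_embDomain, Finsupp.support_embDomain, Finsupp.support_embDomain,
    support_parts] at hs
  have hr : Set.range i = Set.range i' := by
    have := congrArg (fun s : Finset ℕ => (s : Set ℕ)) hs
    simpa using this
  exact OrderEmbedding.range_inj.mp hr

theorem exists_expo_of_pack {α : IntComp} {d : ℕ →₀ ℕ}
    (h : pack d = α.map (fun a : ℕ+ => (a : ℕ))) : ∃ i, expo α i = d := by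
  have hc : d.support.card = α.length := by
    have := congrArg List.length h
    simpa [pack] using this
  refine ⟨d.support.orderEmbOfFin hc, ?_⟩
  have hget : ∀ j : Fin α.length, d (d.support.orderEmbOfFin hc j) = (α.get j : ℕ) := by
    intro j
    have h1 := List.getElem_of_eq h (i := j) (by simp [pack, hc])
    simp only [pack, List.getElem_map] at h1
    simpa [Finset.orderEmbOfFin_apply] using h1
  have hd : d = Finsupp.embDomain (d.support.orderEmbOfFin hc).toEmbedding (parts α) := by
    ext x
    by_cases hx : x ∈ d.support
    · have : x ∈ Set.range (d.support.orderEmbOfFin hc) := by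
        rw [Finset.range_orderEmbOfFin]; exact hx
      obtain ⟨j, rfl⟩ := this
      have := Finsupp.embDomain_apply_self (d.support.orderEmbOfFin hc).toEmbedding (parts α) j
      simp only [RelEmbedding.coe_toEmbedding] at this
      rw [this, hget]
      rfl
    · rw [Finsupp.embDomain_of_notMem_range, Finsupp.notMem_support_iff.mp hx]
      simp only [RelEmbedding.coe_toEmbedding, Finset.range_orderEmbOfFin]
      exact hx
  rw [expo_eq_embDomain]
  exact hd.symm

variable (k : Type*) [Field k]

theorem coeff_monomialPS (α : IntComp) (d : ℕ →₀ ℕ) :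
    MvPowerSeries.coeff d (monomialPS k α) =
      if pack d = α.map (fun a : ℕ+ => (a : ℕ)) then 1 else 0 := by
  change (({i : Fin α.length ↪o ℕ | expo α i = d}.ncard : ℕ) : k) = _
  split_ifs with h
  · obtain ⟨i, rfl⟩ := exists_expo_of_pack h
    have : {i' : Fin α.length ↪o ℕ | expo α i' = expo α i} = {i} := by
      ext i'
      simp [(expo_injective α).eq_iff]
    rw [this]
    simp
  · have : {i : Fin α.length ↪o ℕ | expo α i = d} = ∅ := by
      ext i
      simp only [Set.mem_ofPred_eq, Set.mem_empty_iff_false, iff_false]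
      rintro rfl
      exact h (pack_expo α i)
    rw [this]
    simp

/-- The exponent vector of `x_0 ^ a₁ ⋯ x_{m-1} ^ aₘ`. -/
def leading (α : IntComp) : ℕ →₀ ℕ := expo α (Fin.valOrderEmb α.length)

theorem coeff_leading (α β : IntComp) :
    MvPowerSeries.coeff (leading β) (monomialPS k α) = if β = α then 1 else 0 := by
  rw [coeff_monomialPS, leading, pack_expo]
  simp [(List.map_injective_iff.mpr PNat.coe_injective).eq_iff]

theorem linearIndependent_monomialPS : LinearIndependent k (monomialPS k) := by
  rw [linearIndependent_iff]
  intro l hl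
  ext β
  have h := congrArg (MvPowerSeries.coeff (leading β)) hl
  rw [Finsupp.linearCombination_apply, Finsupp.sum, map_sum] at h
  simp only [map_smul, coeff_leading, smul_eq_mul, mul_ite, mul_one, mul_zero, map_zero,
    Finset.sum_ite_eq, Finsupp.mem_support_iff] at h
  by_contra hne
  exact hne (by simpa [hne] using h)

theorem degree_eq_sum_pack (d : ℕ →₀ ℕ) : d.degree = (pack d).sum := by
  rw [pack, Finsupp.degree_apply, ← Finset.sum_map_toList]
  exact (((Finset.sort_perm_toList _ _).map d).sum_eq).symm

/-- Power series of bounded degree whose coefficients are invariant under order-preserving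
relabelling of the variables. -/
def IsQuasiSym (f : MvPowerSeries ℕ k) : Prop :=
  (∃ N : ℕ, ∀ d : ℕ →₀ ℕ, N < d.degree → MvPowerSeries.coeff d f = 0) ∧
  ∀ (m : ℕ) (i i' : Fin m ↪o ℕ) (c : Fin m →₀ ℕ),
    MvPowerSeries.coeff (Finsupp.embDomain i.toEmbedding c) f =
      MvPowerSeries.coeff (Finsupp.embDomain i'.toEmbedding c) f

/-- Every list of nonzero exponents is a composition. -/
theorem exists_pack_eq (d : ℕ →₀ ℕ) :
    ∃ α : IntComp, pack d = α.map (fun a : ℕ+ => (a : ℕ)) := by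
  have h : ∀ a ∈ pack d, 0 < a := by
    intro a ha
    simp only [pack, List.mem_map, Finset.mem_sort, Finsupp.mem_support_iff] at ha
    obtain ⟨x, hx, rfl⟩ := ha
    omega
  refine ⟨(pack d).map Nat.toPNat', ?_⟩
  rw [List.map_map]
  conv_lhs => rw [← List.map_id (pack d)]
  refine List.map_congr_left fun a ha => ?_
  simp only [id_eq, Function.comp_apply, Nat.toPNat'_coe, if_pos (h a ha)]

theorem mem_span_iff (f : MvPowerSeries ℕ k) :
    f ∈ Submodule.span k (Set.range (monomialPS k)) ↔ IsQuasiSym k f := by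
  constructor
  · intro hf
    induction hf using Submodule.span_induction with
    | mem f hf =>
      obtain ⟨α, rfl⟩ := hf
      refine ⟨⟨IntComp.size α, fun d hd => ?_⟩, fun m i i' c => ?_⟩
      · rw [coeff_monomialPS, if_neg]
        intro h
        rw [degree_eq_sum_pack, h] at hd
        exact lt_irrefl _ hd
      · simp only [coeff_monomialPS, pack_embDomain]
    | zero => exact ⟨⟨0, fun d _ => by simp⟩, fun m i i' c => by simp⟩
    | add f g _ _ hf hg =>
      obtain ⟨⟨N, hN⟩, hf⟩ := hf
      obtain ⟨⟨N', hN'⟩, hg⟩ := hg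
      refine ⟨⟨max N N', fun d hd => ?_⟩, fun m i i' c => ?_⟩
      · rw [map_add, hN d (by omega), hN' d (by omega), add_zero]
      · rw [map_add, map_add, hf m i i' c, hg m i i' c]
    | smul a f _ hf =>
      obtain ⟨⟨N, hN⟩, hf⟩ := hf
      refine ⟨⟨N, fun d hd => ?_⟩, fun m i i' c => ?_⟩
      · rw [map_smul, hN d hd, smul_zero]
      · rw [map_smul, map_smul, hf m i i' c]
  · rintro ⟨⟨N, hN⟩, hf⟩
    have hfin := IntComp.finite_size_le N
    have heq : f = ∑ α ∈ hfin.toFinset,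
        MvPowerSeries.coeff (leading α) f • monomialPS k α := by
      ext d
      rw [map_sum]
      simp only [map_smul, coeff_monomialPS, smul_eq_mul, mul_ite, mul_one, mul_zero]
      obtain ⟨α, hα⟩ := exists_pack_eq d
      have hiff : ∀ β : IntComp, (pack d = β.map (fun a : ℕ+ => (a : ℕ))) ↔ α = β := by
        intro β
        rw [hα, (List.map_injective_iff.mpr PNat.coe_injective).eq_iff]
      simp only [hiff, Finset.sum_ite_eq, Set.Finite.mem_toFinset, Set.mem_ofPred_eq]
      split_ifs with h
      · obtain ⟨i, rfl⟩ := exists_expo_of_pack hα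
        rw [leading, expo_eq_embDomain, expo_eq_embDomain]
        exact hf _ _ _ _
      · apply hN
        rw [degree_eq_sum_pack, hα]
        exact not_le.mp h
    rw [heq]
    exact Submodule.sum_mem _ fun α _ =>
      Submodule.smul_mem _ _ (Submodule.subset_span ⟨α, rfl⟩)

theorem monomialPS_nil : monomialPS k [] = 1 := by
  ext d
  rw [coeff_monomialPS, MvPowerSeries.coeff_one]
  have : pack d = [] ↔ d = 0 := by
    rw [pack, List.map_eq_nil_iff, ← List.length_eq_zero_iff, Finset.length_sort,
      Finset.card_eq_zero, Finsupp.support_eq_empty]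
  simp [this]

theorem isQuasiSym_mul {f g : MvPowerSeries ℕ k} (hf : IsQuasiSym k f) (hg : IsQuasiSym k g) :
    IsQuasiSym k (f * g) := by
  classical
  obtain ⟨⟨N, hN⟩, hf⟩ := hf
  obtain ⟨⟨N', hN'⟩, hg⟩ := hg
  refine ⟨⟨N + N', fun d hd => ?_⟩, fun m i i' c => ?_⟩
  · rw [MvPowerSeries.coeff_mul]
    refine Finset.sum_eq_zero fun p hp => ?_
    rw [Finset.HasAntidiagonal.mem_antidiagonal] at hp
    rw [← hp, map_add] at hd
    by_cases h : N < p.1.degree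
    · rw [hN _ h, zero_mul]
    · rw [hN' _ (by omega), mul_zero]
  · have key : ∀ i : Fin m ↪o ℕ,
        MvPowerSeries.coeff (Finsupp.embDomain i.toEmbedding c) (f * g) =
          ∑ p ∈ Finset.HasAntidiagonal.antidiagonal c,
            MvPowerSeries.coeff (Finsupp.embDomain i.toEmbedding p.1) f *
              MvPowerSeries.coeff (Finsupp.embDomain i.toEmbedding p.2) g := by
      intro i
      rw [MvPowerSeries.coeff_mul, ← Finsupp.image_prodMap_embDomain_antidiagonal,
        Finset.sum_image]
      · rfl
      · exact (Function.Injective.prodMap (Finsupp.embDomain_injective _)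
          (Finsupp.embDomain_injective _)).injOn
    rw [key i, key i']
    exact Finset.sum_congr rfl fun p _ => by rw [hf m i i' p.1, hg m i i' p.2]

end QuasiSym

open QuasiSym in
/-- The algebra of quasi-symmetric functions over `k`: the linear span of all `M_α` in the algebra
of formal power series. -/
def QSym (k : Type*) [Field k] : Subalgebra k (MvPowerSeries ℕ k) where
  carrier := Submodule.span k (Set.range (monomialPS k))
  mul_mem' {f g} hf hg := (mem_span_iff k _).2
    (isQuasiSym_mul k ((mem_span_iff k f).1 hf) ((mem_span_iff k g).1 hg))
  add_mem' hf hg := Submodule.add_mem _ hf hg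
  algebraMap_mem' r := by
    rw [Algebra.algebraMap_eq_smul_one, ← monomialPS_nil]
    exact Submodule.smul_mem _ _ (Submodule.subset_span ⟨[], rfl⟩)

namespace QSym

open QuasiSym

variable (k : Type*) [Field k]

/-- The monomial quasi-symmetric functions, as elements of `QSym`. -/
def M (α : IntComp) : QSym k := ⟨monomialPS k α, Submodule.subset_span ⟨α, rfl⟩⟩

/-- The `M_α` form a basis of `QSym`. -/
def basisM : Module.Basis IntComp k (QSym k) :=
  Module.Basis.mk (v := M k)
    (LinearIndependent.of_comp (QSym k).val.toLinearMap (linearIndependent_monomialPS k))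
    (by
      rintro ⟨f, hf⟩ -
      have hmap : (Submodule.span k (Set.range (M k))).map (QSym k).val.toLinearMap =
          Submodule.span k (Set.range (monomialPS k)) := by
        rw [Submodule.map_span, ← Set.range_comp]
        rfl
      have hf' : f ∈ (Submodule.span k (Set.range (M k))).map (QSym k).val.toLinearMap := by
        rw [hmap]; exact hf
      obtain ⟨g, hg, hgf⟩ := hf'
      have : g = ⟨f, hf⟩ := Subtype.ext hgf
      exact this ▸ hg)

@[simp]
theorem basisM_apply (α : IntComp) : basisM k α = M k α := by
  simp [basisM]

/-! ### The coalgebra structure -/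

/-- `Δ(M_α) = ∑ M_β ⊗ M_γ`, the sum over all ways to write `α` as a concatenation `βγ`. -/
def comulQ : QSym k →ₗ[k] QSym k ⊗[k] QSym k :=
  (basisM k).constr k fun α =>
    ∑ i ∈ Finset.range (α.length + 1), M k (α.take i) ⊗ₜ[k] M k (α.drop i)

/-- The counit is the projection onto degree `0`. -/
def counitQ : QSym k →ₗ[k] k :=
  (basisM k).constr k fun α => if α = [] then 1 else 0

theorem comulQ_M (α : IntComp) : comulQ k (M k α) =
    ∑ i ∈ Finset.range (α.length + 1), M k (α.take i) ⊗ₜ[k] M k (α.drop i) := by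
  rw [← basisM_apply, comulQ, Module.Basis.constr_basis]

theorem counitQ_M (α : IntComp) : counitQ k (M k α) = if α = [] then 1 else 0 := by
  rw [← basisM_apply, counitQ, Module.Basis.constr_basis]

instance : Coalgebra k (QSym k) where
  comul := comulQ k
  counit := counitQ k
  coassoc := by
    refine (basisM k).ext fun α => ?_
    simp only [basisM_apply, LinearMap.comp_apply, comulQ_M, map_sum, LinearMap.rTensor_tmul,
      LinearMap.lTensor_tmul, TensorProduct.sum_tmul, TensorProduct.tmul_sum,
      LinearEquiv.coe_coe, TensorProduct.assoc_tmul]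
    rw [Finset.sum_sigma', Finset.sum_sigma']
    refine Finset.sum_bij' (fun p _ => ⟨p.2, p.1 - p.2⟩) (fun p _ => ⟨p.1 + p.2, p.1⟩) ?_ ?_ ?_ ?_ ?_
    · rintro ⟨i, j⟩ h
      simp only [Finset.mem_sigma, Finset.mem_range, List.length_take, List.length_drop] at h ⊢
      omega
    · rintro ⟨i, j⟩ h
      simp only [Finset.mem_sigma, Finset.mem_range, List.length_take, List.length_drop] at h ⊢
      omega
    · rintro ⟨i, j⟩ h
      simp only [Finset.mem_sigma, Finset.mem_range, List.length_take] at h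
      simp only [Sigma.mk.injEq, heq_eq_eq, and_true]
      omega
    · rintro ⟨i, j⟩ h
      simp only [Sigma.mk.injEq, heq_eq_eq, true_and]
      omega
    · rintro ⟨i, j⟩ h
      simp only [Finset.mem_sigma, Finset.mem_range, List.length_take] at h
      have hij : j ≤ i := by omega
      have h1 : List.take j (List.take i α) = List.take j α := by
        rw [List.take_take, min_eq_left hij]
      have h2 : List.drop j (List.take i α) = List.take (i - j) (List.drop j α) := by
        rw [List.drop_take]
      have h3 : List.drop (i - j) (List.drop j α) = List.drop i α := by
        rw [List.drop_drop]
        congr 1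
        omega
      simp only [h1, h2, h3]
  rTensor_counit_comp_comul := by
    refine (basisM k).ext fun α => ?_
    simp only [basisM_apply, LinearMap.comp_apply, comulQ_M, map_sum, LinearMap.rTensor_tmul,
      counitQ_M, TensorProduct.mk_apply]
    rw [Finset.sum_eq_single 0]
    · simp
    · intro i hi h0
      rw [Finset.mem_range] at hi
      have : List.take i α ≠ [] := by
        rw [ne_eq, List.take_eq_nil_iff]
        rintro (h | rfl)
        · exact h0 h
        · simp at hi; exact h0 hi
      simp [this]
    · simp
  lTensor_counit_comp_comul := by
    refine (basisM k).ext fun α => ?_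
    simp only [basisM_apply, LinearMap.comp_apply, comulQ_M, map_sum, LinearMap.lTensor_tmul,
      counitQ_M, LinearMap.flip_apply, TensorProduct.mk_apply]
    rw [Finset.sum_eq_single α.length]
    · simp
    · intro i hi h0
      rw [Finset.mem_range] at hi
      have : List.drop i α ≠ [] := by
        rw [ne_eq, List.drop_eq_nil_iff]
        omega
      simp [this]
    · simp

/-! ### The grading -/

/-- The homogeneous component of degree `n`, spanned by the `M_α` with `|α| = n`. -/
def grading (n : ℕ) : Submodule k (QSym k) :=
  Submodule.span k (M k '' {α | IntComp.size α = n})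

theorem M_mem_grading (α : IntComp) : M k α ∈ grading k (IntComp.size α) :=
  Submodule.subset_span ⟨α, rfl, rfl⟩

/-- The map that sends each `M_α` to its copy in degree `|α|`. -/
def decomposeQ : QSym k →ₗ[k] DirectSum ℕ (fun n => grading k n) :=
  (basisM k).constr k fun α =>
    DirectSum.lof k ℕ (fun n => grading k n) (IntComp.size α) ⟨M k α, M_mem_grading k α⟩

theorem decomposeQ_M (α : IntComp) : decomposeQ k (M k α) =
    DirectSum.lof k ℕ (fun n => grading k n) (IntComp.size α) ⟨M k α, M_mem_grading k α⟩ := by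
  have h := (basisM k).constr_basis k (fun α =>
    DirectSum.lof k ℕ (fun n => grading k n) (IntComp.size α) ⟨M k α, M_mem_grading k α⟩) α
  rw [basisM_apply] at h
  exact h

theorem decomposeQ_of_mem (n : ℕ) (x : QSym k) (hx : x ∈ grading k n) :
    decomposeQ k x = DirectSum.lof k ℕ (fun n => grading k n) n ⟨x, hx⟩ := by
  induction hx using Submodule.span_induction with
  | mem x hx =>
    obtain ⟨α, rfl, rfl⟩ := hx
    exact decomposeQ_M k α
  | zero => rw [map_zero]; exact (map_zero _).symm
  | add x y hx hy ihx ihy => rw [map_add, ihx, ihy, ← map_add]; rfl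
  | smul a x hx ih => rw [map_smul, ih, ← map_smul]; rfl

instance : DirectSum.Decomposition (grading k) :=
  DirectSum.Decomposition.ofLinearMap (grading k) (decomposeQ k)
    (by
      refine (basisM k).ext fun α => ?_
      simp only [basisM_apply, LinearMap.comp_apply, decomposeQ_M]
      simp)
    (by
      refine DirectSum.linearMap_ext k fun n => LinearMap.ext fun x => ?_
      simp only [LinearMap.comp_apply, DirectSum.coeLinearMap_lof, LinearMap.id_apply]
      exact decomposeQ_of_mem k n x x.2)

/-! ### The canonical character -/

/-- Setting all variables except the first one to `0`; the result is a polynomial in the first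
variable because quasi-symmetric functions have bounded degree. -/
theorem exists_restrict (f : QSym k) : ∃ p : Polynomial k,
    ∀ n, p.coeff n = MvPowerSeries.coeff (Finsupp.single 0 n) (f : MvPowerSeries ℕ k) := by
  obtain ⟨⟨N, hN⟩, -⟩ := (mem_span_iff k _).1 f.2
  refine ⟨PowerSeries.trunc (N + 1)
    (PowerSeries.mk fun n => MvPowerSeries.coeff (Finsupp.single 0 n) f.1), fun n => ?_⟩
  rw [PowerSeries.coeff_trunc, PowerSeries.coeff_mk]
  split_ifs with h
  · rfl
  · rw [hN _ (by simp; omega)]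

/-- The algebra morphism from `QSym` to the polynomials in the first variable that sets all other
variables to `0`. -/
def restrict : QSym k →ₐ[k] Polynomial k :=
  AlgHom.ofLinearMap
    { toFun := fun f => (exists_restrict k f).choose
      map_add' := fun f g => by
        ext n
        rw [Polynomial.coeff_add]
        simp only [(exists_restrict k _).choose_spec]
        simp
      map_smul' := fun a f => by
        ext n
        rw [RingHom.id_apply, Polynomial.coeff_smul]
        simp only [(exists_restrict k _).choose_spec]
        simp }
    (by
      ext n
      simp only [LinearMap.coe_mk, AddHom.coe_mk]
      rw [(exists_restrict k _).choose_spec, Polynomial.coeff_one]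
      simp [MvPowerSeries.coeff_one])
    (by
      intro f g
      ext n
      simp only [LinearMap.coe_mk, AddHom.coe_mk]
      rw [(exists_restrict k _).choose_spec, Polynomial.coeff_mul]
      simp only [(exists_restrict k _).choose_spec]
      classical
      rw [MulMemClass.coe_mul, MvPowerSeries.coeff_mul, Finsupp.antidiagonal_single,
        Finset.sum_map]
      rfl)

theorem coeff_restrict (f : QSym k) (n : ℕ) : (restrict k f).coeff n =
    MvPowerSeries.coeff (Finsupp.single 0 n) (f : MvPowerSeries ℕ k) :=
  (exists_restrict k f).choose_spec n

/-- The canonical character `ζ_Q` of `QSym`: the algebra morphism that sets the first variable to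
`1` and all other variables to `0`. -/
def zeta : QSym k →ₐ[k] k := (Polynomial.aeval (1 : k)).comp (restrict k)

end QSym

end

/-! The span of the even `M_α` is a graded subcoalgebra, because prefixes and suffixes of an even
composition are even. It lives in even degrees, where the two functionals coincide, so it lies in
the even subalgebra `C` (`evenSpan_le_evenSubalgebra`).

Conversely, let `h ∈ C` and let `α = β a γ` have an odd part `a`. Contracting coproducts with the
coordinate functionals of `β` on the left and then of `γ` on the right gives an element of `C` whose
coefficient at `(a)` is the coefficient `c` of `h` at `α` (`coord_contract_left`,
`coord_contract_right`). Its component of degree `a` is still in `C`, and `ζ` takes the value `c`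
there (`zeta_decompose`), since `ζ` kills every `M` with two or more parts. Agreement of the
functionals in odd degree reads `-c = c`, so `c = 0` away from characteristic `2`. Hence only even
compositions occur in `h`. -/

/-! ### Contraction of tensors in `C ⊗ C`. -/

/-- A pure tensor `x ⊗ y` contracts to `φ x • y`, a multiple of its right factor. Applied to
coproducts, this keeps prefix stripping inside a subcoalgebra. -/
theorem TensorProduct.lid_rTensor_mem_of_mem_range_map {k H : Type*} [Field k] [AddCommGroup H]
    [Module k H] {C : Submodule k H} {t : H ⊗[k] H}
    (ht : t ∈ LinearMap.range (TensorProduct.map C.subtype C.subtype)) (φ : H →ₗ[k] k) :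
    TensorProduct.lid k H (φ.rTensor H t) ∈ C := by
  obtain ⟨s, rfl⟩ := ht
  induction s with
  | zero => simp
  | tmul x y => simpa using C.smul_mem _ y.2
  | add x y hx hy => simpa only [map_add] using C.add_mem hx hy

theorem TensorProduct.rid_lTensor_mem_of_mem_range_map {k H : Type*} [Field k] [AddCommGroup H]
    [Module k H] {C : Submodule k H} {t : H ⊗[k] H}
    (ht : t ∈ LinearMap.range (TensorProduct.map C.subtype C.subtype)) (φ : H →ₗ[k] k) :
    TensorProduct.rid k H (φ.lTensor H t) ∈ C := by
  obtain ⟨s, rfl⟩ := ht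
  induction s with
  | zero => simp
  | tmul x y => simpa using C.smul_mem _ x.2
  | add x y hx hy => simpa only [map_add] using C.add_mem hx hy

namespace QSym

open QuasiSym

variable (k : Type*) [Field k]

/-! ### Coordinates and deconcatenation. -/

theorem coord_M (α β : IntComp) : (basisM k).coord β (M k α) = if α = β then 1 else 0 := by
  rw [← basisM_apply, Module.Basis.coord_apply, Module.Basis.repr_self, Finsupp.single_apply]

/-- Cutting at `i` within the range produces a prefix of length exactly `i`, so only the cut at
`β.length` can contribute. -/
theorem sum_take_drop (α β γ : IntComp) :
    ∑ i ∈ Finset.range (α.length + 1),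
      (if α.take i = β then (1 : k) else 0) * (if α.drop i = γ then 1 else 0) =
    if α = β ++ γ then 1 else 0 := by
  split_ifs with h
  · subst h
    rw [Finset.sum_eq_single β.length]
    · simp
    · intro i hi hne
      rw [if_neg, zero_mul]
      intro h
      have := congrArg List.length h
      simp only [List.length_take, Finset.mem_range] at this hi
      omega
    · simp
  · refine Finset.sum_eq_zero fun i _ => ?_
    split_ifs with h1 h2
    · exact absurd (by rw [← h1, ← h2, List.take_append_drop]) h
    all_goals simp

/-- Contracting the left factor of the coproduct with the coordinate of `β` strips the prefix `β`. -/
theorem coord_contract_left (β γ : IntComp) (h : QSym k) :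
    (basisM k).coord γ (TensorProduct.lid k (QSym k) (((basisM k).coord β).rTensor (QSym k)
      (CoalgebraStruct.comul h))) = (basisM k).coord (β ++ γ) h := by
  -- Both sides are linear in `h`, so it is enough to compare them on the `M_α`.
  suffices (basisM k).coord γ ∘ₗ (TensorProduct.lid k (QSym k)).toLinearMap ∘ₗ
      ((basisM k).coord β).rTensor (QSym k) ∘ₗ comulQ k = (basisM k).coord (β ++ γ) from
    LinearMap.congr_fun this h
  refine (basisM k).ext fun α => ?_
  simp only [basisM_apply, LinearMap.comp_apply, comulQ_M, map_sum, LinearMap.rTensor_tmul,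
    LinearEquiv.coe_coe, TensorProduct.lid_tmul, map_smul, coord_M, smul_eq_mul]
  exact sum_take_drop k α β γ

/-- Contracting the right factor of the coproduct with the coordinate of `γ` strips the suffix
`γ`. -/
theorem coord_contract_right (β γ : IntComp) (h : QSym k) :
    (basisM k).coord β (TensorProduct.rid k (QSym k) (((basisM k).coord γ).lTensor (QSym k)
      (CoalgebraStruct.comul h))) = (basisM k).coord (β ++ γ) h := by
  suffices (basisM k).coord β ∘ₗ (TensorProduct.rid k (QSym k)).toLinearMap ∘ₗ
      ((basisM k).coord γ).lTensor (QSym k) ∘ₗ comulQ k = (basisM k).coord (β ++ γ) from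
    LinearMap.congr_fun this h
  refine (basisM k).ext fun α => ?_
  simp only [basisM_apply, LinearMap.comp_apply, comulQ_M, map_sum, LinearMap.lTensor_tmul,
    LinearEquiv.coe_coe, TensorProduct.rid_tmul, map_smul, coord_M, smul_eq_mul]
  rw [← sum_take_drop k α β γ]
  exact Finset.sum_congr rfl fun i _ => mul_comm _ _

/-! ### The canonical character and the grading. -/

theorem pack_single_zero (n : ℕ) :
    pack (Finsupp.single (0 : ℕ) n) = if n = 0 then [] else [n] := by
  split_ifs with h
  · simp [pack, h]
  · simp [pack, Finsupp.support_single, h]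

/-- Every monomial of `M_α` involves `α.length` distinct variables, so two or more parts leave
nothing in the first variable alone. Otherwise the restriction is the single power `X ^ |α|`, which
is `1` at `X = 1`. -/
theorem zeta_M (α : IntComp) : zeta k (M k α) = if α.length ≤ 1 then 1 else 0 := by
  have hco (n : ℕ) : (restrict k (M k α)).coeff n =
      if (if n = 0 then [] else [n]) = α.map (fun a : ℕ+ => (a : ℕ)) then 1 else 0 := by
    rw [coeff_restrict, ← pack_single_zero]
    exact coeff_monomialPS k α _
  have hr : restrict k (M k α) =
      if α.length ≤ 1 then Polynomial.X ^ IntComp.size α else 0 := by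
    ext n
    rw [hco]
    rcases α with _ | ⟨a, _ | ⟨b, l⟩⟩
    · by_cases hn : n = 0 <;> simp [hn, IntComp.size, Polynomial.coeff_one]
    · have ha := a.ne_zero
      by_cases hn : n = 0
      · simp [hn, IntComp.size, Polynomial.coeff_X_pow, ha.symm]
      · simp [hn, IntComp.size, Polynomial.coeff_X_pow]
    · by_cases hn : n = 0 <;> simp [hn]
  change Polynomial.aeval (1 : k) (restrict k (M k α)) = _
  rw [hr]
  split_ifs <;> simp

theorem decompose_M (α : IntComp) (n : ℕ) :
    (DirectSum.decompose (grading k) (M k α) n : QSym k) =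
      if IntComp.size α = n then M k α else 0 := by
  split_ifs with h
  · exact DirectSum.decompose_of_mem_same _ (h ▸ M_mem_grading k α)
  · exact DirectSum.decompose_of_mem_ne _ (M_mem_grading k α) h

theorem bar_of_mem {φ : QSym k →ₗ[k] k} {n : ℕ} {h : QSym k} (hh : h ∈ grading k n) :
    CombHopf.bar (grading k) φ h = (-1) ^ n * φ h := by
  rw [CombHopf.bar, LinearMap.comp_apply, CombHopf.signInvolution_of_mem _ hh, map_smul,
    smul_eq_mul]

/-- In positive degree `a`, the canonical character reads off the coordinate of `(a)`. -/
theorem zeta_decompose (a : ℕ+) (h : QSym k) :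
    zeta k (DirectSum.decompose (grading k) h (a : ℕ)) = (basisM k).coord [a] h := by
  suffices (zeta k).toLinearMap ∘ₗ (grading k a).subtype ∘ₗ
      DirectSum.component k ℕ (fun n => grading k n) a ∘ₗ
      (DirectSum.decomposeLinearEquiv (grading k)).toLinearMap = (basisM k).coord [a] from
    LinearMap.congr_fun this h
  refine (basisM k).ext fun α => ?_
  rw [basisM_apply, coord_M]
  change zeta k (DirectSum.decompose (grading k) (M k α) (a : ℕ)) = _
  rw [decompose_M, apply_ite (zeta k), zeta_M, map_zero]
  -- `ζ` is also `1` on the empty composition; positivity of `a` excludes that case. For one part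
  -- the degree determines the composition, and longer ones are killed by `ζ`.
  rcases α with _ | ⟨b, _ | ⟨c, l⟩⟩
  · simp [IntComp.size, a.ne_zero.symm]
  · simp [IntComp.size]
  · simp

/-! ### The two inclusions. -/

/-- The span of the `M_α` with `α` even. -/
noncomputable def evenSpan : Submodule k (QSym k) :=
  Submodule.span k (Set.range fun α : {α : IntComp // IntComp.IsEven α} => M k α)

theorem M_mem_evenSpan {α : IntComp} (hα : IntComp.IsEven α) : M k α ∈ evenSpan k :=
  Submodule.subset_span ⟨⟨α, hα⟩, rfl⟩

theorem even_size {α : IntComp} (hα : IntComp.IsEven α) : Even (IntComp.size α) := by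
  refine List.sum_induction Even (fun _ _ => Even.add) Even.zero fun n hn => ?_
  obtain ⟨a, ha, rfl⟩ := List.mem_map.1 hn
  exact hα a ha

theorem isGradedSubcoalgebra_evenSpan :
    CombHopf.IsGradedSubcoalgebra (grading k) (evenSpan k) where
  homogeneous i h hh := by
    induction hh using Submodule.span_induction with
    | mem x hx =>
      obtain ⟨α, rfl⟩ := hx
      rw [decompose_M]
      split_ifs
      · exact M_mem_evenSpan k α.2
      · exact Submodule.zero_mem _
    | zero => simp
    | add x y _ _ hx hy => simpa using Submodule.add_mem _ hx hy
    | smul a x _ hx =>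
      rw [DirectSum.decompose_smul]
      exact Submodule.smul_mem _ a hx
  comul_mem h hh := by
    induction hh using Submodule.span_induction with
    | mem x hx =>
      obtain ⟨α, rfl⟩ := hx
      change comulQ k (M k α) ∈ _
      rw [comulQ_M]
      refine Submodule.sum_mem _ fun i _ => ?_
      -- Both pieces of a cut inherit their parts from `α`, hence are even.
      exact ⟨⟨_, M_mem_evenSpan k fun a ha => α.2 a (List.mem_of_mem_take ha)⟩ ⊗ₜ
        ⟨_, M_mem_evenSpan k fun a ha => α.2 a (List.mem_of_mem_drop ha)⟩,
        TensorProduct.map_tmul _ _ _ _⟩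
    | zero => rw [map_zero]; exact Submodule.zero_mem _
    | add x y _ _ hx hy => rw [map_add]; exact Submodule.add_mem _ hx hy
    | smul a x _ hx => rw [map_smul]; exact Submodule.smul_mem _ a hx

theorem evenSpan_le_evenSubalgebra :
    evenSpan k ≤ CombHopf.evenSubalgebra (grading k) (zeta k) := by
  refine (CombHopf.isGreatest_largestSubcoalgebra (grading k) _ _).2
    ⟨isGradedSubcoalgebra_evenSpan k, ?_⟩
  suffices evenSpan k ≤
      LinearMap.eqLocus (CombHopf.bar (grading k) (zeta k).toLinearMap) (zeta k).toLinearMap from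
    fun h hh => this hh
  rw [evenSpan, Submodule.span_le]
  rintro _ ⟨α, rfl⟩
  change CombHopf.bar (grading k) (zeta k).toLinearMap (M k α) = (zeta k).toLinearMap (M k α)
  rw [bar_of_mem k (M_mem_grading k α), (even_size α.2).neg_one_pow, one_mul]

/-- An odd part anywhere in a composition can be isolated by two contractions, which reduces the
claim to one-part compositions, settled by `hone`. -/
theorem evenSubalgebra_le_evenSpan (hk : ringChar k ≠ 2) :
    CombHopf.evenSubalgebra (grading k) (zeta k) ≤ evenSpan k := by
  obtain ⟨⟨hC, hagree⟩, -⟩ := CombHopf.isGreatest_largestSubcoalgebra (grading k)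
    (CombHopf.bar (grading k) (zeta k).toLinearMap) (zeta k).toLinearMap
  change CombHopf.IsGradedSubcoalgebra _ (CombHopf.evenSubalgebra (grading k) (zeta k)) at hC
  change ∀ h ∈ CombHopf.evenSubalgebra (grading k) (zeta k), _ at hagree
  set C := CombHopf.evenSubalgebra (grading k) (zeta k)
  have hone (a : ℕ+) (ha : ¬ Even (a : ℕ)) (h : QSym k) (hh : h ∈ C) :
      (basisM k).coord [a] h = 0 := by
    -- The agreement must be applied to the component of degree `a`, where the sign is `-1`; this
    -- needs `C` to be graded.
    have h1 := hagree _ (hC.homogeneous a hh)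
    rw [bar_of_mem k (SetLike.coe_mem _), (Nat.not_even_iff_odd.1 ha).neg_one_pow] at h1
    rw [← zeta_decompose]
    exact (Ring.eq_self_iff_eq_zero_of_char_ne_two hk).1 ((neg_one_mul _).symm.trans h1)
  intro h hh
  rw [← (basisM k).linearCombination_repr h, Finsupp.linearCombination_apply]
  refine Submodule.sum_mem _ fun α hα => Submodule.smul_mem _ _ ?_
  rw [basisM_apply]
  refine M_mem_evenSpan k fun a ha => ?_
  by_contra hodd
  obtain ⟨β, γ, rfl⟩ := List.append_of_mem ha
  refine Finsupp.mem_support_iff.1 hα ?_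
  -- Strip `β`, regard the remaining `a :: γ` as `[a] ++ γ`, then strip `γ`.
  rw [← Module.Basis.coord_apply, ← coord_contract_left, ← List.singleton_append,
    ← coord_contract_right]
  exact hone a hodd _ (TensorProduct.rid_lTensor_mem_of_mem_range_map (hC.comul_mem _
    (TensorProduct.lid_rTensor_mem_of_mem_range_map (hC.comul_mem _ hh) _)) _)

end QSym

theorem propositionP (k : Type*) [Field k] (hk : ringChar k ≠ 2) :
    ∃ b : Module.Basis {α : IntComp // IntComp.IsEven α} k
        (CombHopf.evenSubalgebra (QSym.grading k) (QSym.zeta k)),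
      ∀ α, (b α : QSym k) = QSym.M k α := by
  have hli : LinearIndependent k fun α : {α : IntComp // IntComp.IsEven α} => QSym.M k α := by
    have := (QSym.basisM k).linearIndependent.comp
      (Subtype.val : {α : IntComp // IntComp.IsEven α} → IntComp) Subtype.val_injective
    simpa [Function.comp_def] using this
  have heq : QSym.evenSpan k = CombHopf.evenSubalgebra (QSym.grading k) (QSym.zeta k) :=
    le_antisymm (QSym.evenSpan_le_evenSubalgebra k) (QSym.evenSubalgebra_le_evenSpan k hk)
  refine ⟨(Module.Basis.span hli).map (LinearEquiv.ofEq _ _ heq), fun α => ?_⟩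
  exact congrArg Subtype.val (Module.Basis.span_apply hli α)
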